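/- All graphs are finite and simple. For a graph $H$ with $v(H)$ vertices and $n\in\mathbb N$, let $r_H(n)$ be the minimum number $r$ for which there is an edge coloring of the complete graph $K_n$ with $r$ colors that admits no even-chromatic copy of $H$, that is, for which there is no embedding $f\colon H\to K_n$ such that every color occurs on an even number of edges of $f(H)$ (with $r_H(n)=\infty$ if there is no such coloring). Let $\mathbb F_2^{K_n}$ be the $\mathbb F_2$-vector space of all graphs with vertex set $[n]$, where the sum of two graphs is the graph whose edge set is the symmetric difference of their edge sets. A graph $G$ on $[n]$ is a copy of $H$ if there is $S\subseteq[n]$ such that $G[S]$ is isomorphic to $H$ and all vertices of $[n]\setminus S$ are isolated in $G$. Let $$d^{\mathrm{lin}}_H(n)=2^{-\binom n2}\max\{|\mathcal C| : \mathcal C\subseteq\mathbb F_2^{K_n}\text{ is a linear subspace that contains no copy of }H\}$$ (with $d^{\mathrm{lin}}_H(n)=0$ if there is no such subspace). Then for asymptotically almost all graphs $H$ with an even number of edges, $$r_H(n)\ge (1-o(1))\,n^{1/(v(H)-2)}\quad\text{and hence}\quad d^{\mathrm{lin}}_H(n)\le (1+o(1))\,n^{-1/(v(H)-2)}\qquad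 (n\to\infty),$$ where the $o(1)$ terms may depend on $H$. That is, among all graphs $H$ on the vertex set $[k]$ with an even number of edges, the proportion of those for which both bounds hold tends to $1$ as $k\to\infty$. -/

import Mathlib

open Filter Topology
open scoped ENNReal

namespace GraphCode

/-- An edge coloring `χ` of the complete graph on `{0, …, n-1}` admits an even-chromatic copy of
`H` if there is an injective homomorphism `f` from `H` to the complete graph such that every color
occurs on an even number of edges of `f(H)`. -/
def AdmitsEvenChromaticCopy {V K : Type*} {n : ℕ} (H : SimpleGraph V)
    (χ : SimpleGraph.TopEdgeLabeling (Fin n) K) : Prop :=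
  ∃ f : H.Copy (⊤ : SimpleGraph (Fin n)),
    ∀ c : K, Even {e : H.edgeSet | χ (f.mapEdgeSet e) = c}.ncard

/-- `r_H(n)`: the least `r` such that some edge coloring of the complete graph on `n` vertices
with `r` colors admits no even-chromatic copy of `H` (and `⊤` if there is no such coloring). -/
noncomputable def minColors {V : Type*} (H : SimpleGraph V) (n : ℕ) : ℕ∞ :=
  sInf {r : ℕ∞ | ∃ m : ℕ, r = m ∧
    ∃ χ : SimpleGraph.TopEdgeLabeling (Fin n) (Fin m), ¬ AdmitsEvenChromaticCopy H χ}

/-- A graph `G` is a copy of `H` if, for some vertex set `S`, the induced graph `G[S]` is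
isomorphic to `H` and all vertices outside `S` are isolated in `G`. -/
def IsCopyOf {V W : Type*} (G : SimpleGraph W) (H : SimpleGraph V) : Prop :=
  ∃ S : Set W, Nonempty (H ≃g G.induce S) ∧ ∀ w ∉ S, G.IsIsolated w

/-- The vector space over the field with two elements of all graphs on `{0, …, n-1}`: the
coordinates are indexed by the edges of the complete graph. -/
abbrev GraphSpace (n : ℕ) : Type :=
  (⊤ : SimpleGraph (Fin n)).edgeSet → ZMod 2

/-- A graph as an element of the graph space: the indicator vector of its edge set. -/
noncomputable def toVector {n : ℕ} (G : SimpleGraph (Fin n)) : GraphSpace n :=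
  fun e => G.edgeSet.indicator 1 (e : Sym2 (Fin n))

/-- A linear graph code contains a copy of `H`. -/
def ContainsCopy {V : Type*} {n : ℕ} (C : Submodule (ZMod 2) (GraphSpace n))
    (H : SimpleGraph V) : Prop :=
  ∃ G : SimpleGraph (Fin n), toVector G ∈ C ∧ IsCopyOf G H

/-- `d^lin_H(n)`: the largest size of a linear graph code on `n` vertices that contains no copy
of `H`, divided by `2 ^ (n choose 2)` (and `0` if there is no such code, which happens
only if `H` has no edges). -/
noncomputable def linDensity {V : Type*} (H : SimpleGraph V) (n : ℕ) : ℝ :=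
  sSup {x : ℝ | ∃ C : Submodule (ZMod 2) (GraphSpace n),
    ¬ ContainsCopy C H ∧ x = Nat.card C} / 2 ^ n.choose 2

/-- `r_H(n) ≥ (1 - o(1)) n ^ (1 / (k - 2))` as `n → ∞`, where `k` is the number of vertices
of `H`. -/
def ColorBound {k : ℕ} (H : SimpleGraph (Fin k)) : Prop :=
  ∀ ε : ℝ, 0 < ε → ∀ᶠ n : ℕ in atTop,
    ENNReal.ofReal ((1 - ε) * (n : ℝ) ^ (1 / ((k : ℝ) - 2))) ≤ (minColors H n : ℝ≥0∞)

/-- `d^lin_H(n) ≤ (1 + o(1)) n ^ (-1 / (k - 2))` as `n → ∞`, where `k` is the number of vertices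
of `H`. -/
def CodeBound {k : ℕ} (H : SimpleGraph (Fin k)) : Prop :=
  ∀ ε : ℝ, 0 < ε → ∀ᶠ n : ℕ in atTop,
    linDensity H n ≤ (1 + ε) * (n : ℝ) ^ (-1 / ((k : ℝ) - 2))

/-- The graphs on `{0, …, k-1}` with an even number of edges. -/
def evenGraphs (k : ℕ) : Set (SimpleGraph (Fin k)) :=
  {H | Even H.edgeSet.ncard}

end GraphCode

namespace GraphCode

/-! Call `H` eliminable (`Elim`) if its vertices can be deleted one at a time, each having even
degree in what is left. In a coloring with `r` colors such an `H` embeds greedily: place the first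
deleted vertex at `a`, keep only the vertices joined to `a` by its most popular color, and continue
inside that set. The edges from each vertex to later ones are then monochromatic and even in number,
so the copy is even-chromatic (`Elim.exists_even_chromatic`). About `(r + 1) ^ (k - 2)` vertices
suffice, which is the color bound. Coloring each edge by the coset of its unit vector modulo a code
turns this into the code bound (`containsCopy_of_admits`).

It remains to see that almost every graph with an even number of edges is eliminable. Fix an
independent set `R`. A vertex of `R` whose only neighbours among the few remaining outside vertices
are `w` and `w₀` can be deleted to flip the parity of `w`; with one such gadget for each `w ≠ w₀`,
everything can be deleted, evenness of the edge count taking care of `w₀` (`elim_of_gadgets`). To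
reach a state with only `L` outside vertices, delete outside vertices of even degree: with `m` of
them left, all have odd degree with probability `2 ^ (-m)`, and these probabilities sum to at most
`2 ^ (-L)` (`cnt_bad_of_base`). So failure is unlikely given that `R` is independent.

A typical graph has some independent block among many disjoint candidates, and the second moment
method (`cnt_le_of_pairwise_indep`) removes the conditioning. Probabilities are counts of graphs,
and independence comes from toggling single edges. -/

/-! ### Eliminable graphs and their greedy embedding in edge colorings. -/

open scoped Classical in
/-- The number of edges of `G` inside `S` that satisfy `p`. -/
noncomputable def edgeCount {V : Type*} (G : SimpleGraph V) (p : Sym2 V → Prop)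
    (S : Finset V) : ℕ :=
  (S.sym2.filter fun e => e ∈ G.edgeSet ∧ p e).card

open scoped Classical in
/-- The number of neighbours of `v` in `S`. -/
noncomputable def degIn {V : Type*} (G : SimpleGraph V) (S : Finset V) (v : V) : ℕ :=
  (S.filter fun w => G.Adj v w).card

open scoped Classical in
/-- `S` can be emptied by successively deleting vertices of even degree. -/
inductive Elim {V : Type*} (G : SimpleGraph V) : Finset V → Prop
  | empty : Elim G ∅
  | insert (u : V) (S : Finset V) (hu : u ∉ S) (hd : Even (degIn G S u)) (h : Elim G S) :
      Elim G (insert u S)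

open scoped Classical in
theorem edgeCount_insert {V : Type*} (G : SimpleGraph V) (p : Sym2 V → Prop) {S : Finset V}
    {u : V} (hu : u ∉ S) :
    edgeCount G p (insert u S) =
      (S.filter fun w => G.Adj u w ∧ p s(u, w)).card + edgeCount G p S := by
  unfold edgeCount
  rw [Finset.sym2_insert, Finset.filter_union, Finset.card_union_of_disjoint]
  · congr 1
    rw [Finset.filter_image, Finset.card_image_of_injective]
    · congr 1
      ext w
      simp only [Finset.mem_filter, Finset.mem_insert, SimpleGraph.mem_edgeSet]
      constructor
      · rintro ⟨rfl | h, h'⟩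
        · exact absurd h'.1 (G.irrefl)
        · exact ⟨h, h'⟩
      · rintro ⟨h, h'⟩
        exact ⟨Or.inr h, h'⟩
    · intro a b hab
      exact Sym2.congr_right.1 hab
  · rw [Finset.disjoint_left]
    intro e he he'
    simp only [Finset.mem_filter, Finset.mem_image] at he he'
    obtain ⟨⟨b, hb, rfl⟩, -⟩ := he
    exact hu (Finset.mk_mem_sym2_iff.1 he'.1).1

open scoped Classical in
theorem edgeCount_congr {V : Type*} (G : SimpleGraph V) {p q : Sym2 V → Prop} {S : Finset V}
    (h : ∀ e ∈ S.sym2, p e ↔ q e) : edgeCount G p S = edgeCount G q S := by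
  unfold edgeCount
  congr 1
  refine Finset.filter_congr fun e he => ?_
  rw [h e he]

/-- A number of vertices that forces an even-chromatic copy of an eliminable set of size `s` in
every coloring with `r` colors. -/
def ramseySize (r : ℕ) : ℕ → ℕ
  | 0 => 0
  | 1 => 1
  | s + 2 => (r + 1) ^ s + 1

-- Pigeonhole on the colors at `a`. The last two vertices to be embedded need only nonempty sets,
-- whatever the colors; hence the exponent of `ramseySize` is the number of vertices minus two.
open scoped Classical in
theorem exists_large_color_class {W K : Type*} (T : Finset K) (col : Sym2 W → K)
    (hcol : ∀ a b : W, a ≠ b → col s(a, b) ∈ T) {s : ℕ} {A : Finset W} {a : W} (ha : a ∈ A)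
    (hA : ramseySize T.card (s + 1) ≤ A.card) :
    ∃ B ⊆ A.erase a, ∃ c, (∀ b ∈ B, col s(a, b) = c) ∧ ramseySize T.card s ≤ B.card := by
  have hc : (A.erase a).card = A.card - 1 := Finset.card_erase_of_mem ha
  match s with
  | 0 => exact ⟨∅, by simp, col s(a, a), by simp, by simp [ramseySize]⟩
  | 1 =>
    have : 0 < (A.erase a).card := by
      simp [ramseySize] at hA
      omega
    obtain ⟨b, hb⟩ := Finset.card_pos.1 this
    exact ⟨{b}, by simpa using hb, col s(a, b), by simp, by simp [ramseySize]⟩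
  | s + 2 =>
    have hlt : T.card * (T.card + 1) ^ s < (A.erase a).card := by
      simp only [ramseySize] at hA
      have h1 : (T.card + 1) ^ (s + 1) = T.card * (T.card + 1) ^ s + (T.card + 1) ^ s := by ring
      have h2 : 0 < (T.card + 1) ^ s := by positivity
      omega
    obtain ⟨c, -, hc⟩ := Finset.exists_lt_card_fiber_of_mul_lt_card_of_maps_to
      (f := fun b => col s(a, b)) (fun b hb => hcol a b (Finset.ne_of_mem_erase hb).symm) hlt
    exact ⟨_, Finset.filter_subset _ _, c, fun b hb => (Finset.mem_filter.1 hb).2, hc⟩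

open scoped Classical in
theorem Elim.exists_even_chromatic {V W K : Type*} {G : SimpleGraph V} {S : Finset V}
    (hS : Elim G S) (T : Finset K) (col : Sym2 W → K)
    (hcol : ∀ a b : W, a ≠ b → col s(a, b) ∈ T) [Nonempty W] (A : Finset W)
    (hA : ramseySize T.card S.card ≤ A.card) :
    ∃ f : V → W, Set.InjOn f S ∧ (∀ v ∈ S, f v ∈ A) ∧
      ∀ c, Even (edgeCount G (fun e => col (e.map f) = c) S) := by
  induction hS generalizing A with
  | empty => exact ⟨fun _ => Classical.arbitrary W, by simp, by simp, by simp [edgeCount]⟩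
  | insert u S hu hd h ih =>
    rw [Finset.card_insert_of_notMem hu] at hA
    have hpos : 0 < A.card := by
      refine lt_of_lt_of_le ?_ hA
      cases S.card <;> simp [ramseySize]
    obtain ⟨a, ha⟩ := Finset.card_pos.1 hpos
    obtain ⟨B, hBA, c₀, hB, hBc⟩ := exists_large_color_class T col hcol ha hA
    obtain ⟨f, hinj, hmaps, heven⟩ := ih B hBc
    have hne : ∀ v ∈ S, v ≠ u := fun v hv h => hu (h ▸ hv)
    have hupd : ∀ v ∈ S, Function.update f u a v = f v := fun v hv =>
      Function.update_of_ne (hne v hv) _ _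
    refine ⟨Function.update f u a, ?_, ?_, ?_⟩
    · rw [Finset.coe_insert, Set.injOn_insert (by simpa using hu)]
      refine ⟨fun x hx y hy hxy => hinj hx hy ?_, ?_⟩
      · rwa [hupd x hx, hupd y hy] at hxy
      · rintro ⟨v, hv, hva⟩
        rw [hupd v hv, Function.update_self] at hva
        exact Finset.ne_of_mem_erase (hBA (hmaps v hv)) hva
    · intro v hv
      rcases Finset.mem_insert.1 hv with rfl | hv
      · simpa using ha
      · rw [hupd v hv]
        exact Finset.mem_of_mem_erase (hBA (hmaps v hv))
    · intro c
      rw [edgeCount_insert G _ hu]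
      refine Even.add ?_ ?_
      · have : ∀ w ∈ S, col (Sym2.map (Function.update f u a) s(u, w)) = c₀ := by
          intro w hw
          rw [Sym2.map_mk, hupd w hw, Function.update_self]
          exact hB _ (hmaps w hw)
        by_cases hc : c₀ = c
        · rw [Finset.filter_congr (q := fun w => G.Adj u w)
            fun w hw => and_iff_left ((this w hw).trans hc)]
          exact hd
        · rw [Finset.filter_false_of_mem]
          · simp
          · intro w hw hw'
            exact hc ((this w hw).symm.trans hw'.2)
      · rw [edgeCount_congr G (q := fun e => col (e.map f) = c) fun e he => ?_]
        · exact heven c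
        rw [Sym2.map_congr (f := Function.update f u a) (g := f)]
        intro v hv
        exact hupd v (Finset.mem_sym2_iff.1 he v hv)

open scoped Classical in
theorem admitsEvenChromaticCopy_of_elim {k n m : ℕ} {H : SimpleGraph (Fin k)}
    (hH : Elim H Finset.univ) (χ : SimpleGraph.TopEdgeLabeling (Fin n) (Fin m)) (hn0 : 0 < n)
    (hn : ramseySize m k ≤ n) : AdmitsEvenChromaticCopy H χ := by
  have : Nonempty (Fin n) := ⟨⟨0, hn0⟩⟩
  -- Loops receive the extra value `none`, so that `col` is total while proper edges still use only
  -- `m` colors.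
  let col : Sym2 (Fin n) → Option (Fin m) := fun e =>
    if h : e ∈ (⊤ : SimpleGraph (Fin n)).edgeSet then some (χ ⟨e, h⟩) else none
  have hT : (Finset.univ.map Function.Embedding.some : Finset (Option (Fin m))).card = m := by
    simp
  obtain ⟨f, hinj, -, heven⟩ := hH.exists_even_chromatic
    (Finset.univ.map Function.Embedding.some : Finset (Option (Fin m))) col
    (by intro a b hab; simp [col, hab]) Finset.univ (by simpa using hn)
  have hinj' : Function.Injective f := by simpa using hinj
  refine ⟨⟨⟨f, fun {a b} hab => ?_⟩, hinj'⟩, fun c => ?_⟩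
  · exact fun h => hab.ne (hinj' h)
  · have := heven (some c)
    convert this using 1
    unfold edgeCount
    rw [← Set.ncard_image_of_injective _ Subtype.val_injective, ← Set.ncard_coe_finset]
    congr 1
    ext e
    simp only [Set.mem_image, Set.mem_ofPred_eq, Subtype.exists, Finset.coe_filter,
      Finset.mem_sym2_iff, Finset.mem_univ, implies_true, true_and]
    constructor
    · rintro ⟨e', he', h, rfl⟩
      refine ⟨he', ?_⟩
      have hm : e'.map f ∈ (⊤ : SimpleGraph (Fin n)).edgeSet := by
        induction e' with
        | _ x y =>
          simp only [Sym2.map_mk, SimpleGraph.mem_edgeSet, SimpleGraph.top_adj]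
          exact fun h => (SimpleGraph.mem_edgeSet H |>.1 he').ne (hinj' h)
      simp only [col, hm, dite_true]
      exact congrArg some h
    · rintro ⟨he, h⟩
      refine ⟨e, he, ?_, rfl⟩
      have hm : e.map f ∈ (⊤ : SimpleGraph (Fin n)).edgeSet := by
        by_contra hm
        simp only [col, hm, dite_false] at h
        exact absurd h (by simp)
      simp only [col, hm, dite_true] at h
      exact Option.some_injective _ h

theorem le_minColors_of_elim {k n : ℕ} {H : SimpleGraph (Fin k)} (hk : 2 ≤ k)
    (hH : Elim H Finset.univ) {x : ℝ} (hx : (x + 1) ^ (k - 2) + 1 ≤ n) :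
    ENNReal.ofReal x ≤ (minColors H n : ℝ≥0∞) := by
  by_cases hne : {r : ℕ∞ | ∃ m : ℕ, r = m ∧
    ∃ χ : SimpleGraph.TopEdgeLabeling (Fin n) (Fin m), ¬ AdmitsEvenChromaticCopy H χ}.Nonempty
  · obtain ⟨m, hm, χ, hχ⟩ := csInf_mem hne
    have hmin : minColors H n = m := hm
    rw [hmin]
    by_contra! hlt
    have hmx : (m : ℝ) < x := by
      by_contra! h
      refine absurd hlt (not_lt.2 ?_)
      calc ENNReal.ofReal x ≤ ENNReal.ofReal m := ENNReal.ofReal_le_ofReal h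
        _ = _ := by simp
    have hn : (m + 1) ^ (k - 2) + 1 ≤ n := by
      have : ((m : ℝ) + 1) ^ (k - 2) + 1 ≤ n :=
        le_trans (by gcongr) hx
      exact_mod_cast this
    refine hχ (admitsEvenChromaticCopy_of_elim hH χ (by omega) ?_)
    obtain ⟨s, rfl⟩ := Nat.exists_eq_add_of_le' hk
    simpa [ramseySize] using hn
  · rw [Set.not_nonempty_iff_eq_empty] at hne
    rw [minColors, hne]
    simp

theorem colorBound_of_elim {k : ℕ} {H : SimpleGraph (Fin k)} (hk : 3 ≤ k)
    (hH : Elim H Finset.univ) : ColorBound H := by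
  intro ε hε
  wlog hε1 : ε < 1 generalizing ε
  · filter_upwards with n
    rw [ENNReal.ofReal_of_nonpos]
    · simp
    · push Not at hε1
      exact mul_nonpos_of_nonpos_of_nonneg (by linarith) (by positivity)
  have hK : (0 : ℝ) < (k : ℝ) - 2 := by
    have : (3 : ℝ) ≤ k := by exact_mod_cast hk
    linarith
  have hroot : Tendsto (fun n : ℕ => (n : ℝ) ^ (1 / ((k : ℝ) - 2))) atTop atTop :=
    (tendsto_rpow_atTop (by positivity)).comp tendsto_natCast_atTop_atTop
  -- Half of `ε` absorbs the `+ 1` inside the power; the remaining factor `c < 1` leaves room for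
  -- the `+ 1` outside it.
  set c : ℝ := (1 - ε / 2) ^ (k - 2) with hc
  have hc1 : c < 1 := pow_lt_one₀ (by linarith) (by linarith) (by omega)
  have hlin : Tendsto (fun n : ℕ => (1 - c) * (n : ℝ)) atTop atTop :=
    tendsto_natCast_atTop_atTop.const_mul_atTop (by linarith)
  filter_upwards [hroot.eventually_ge_atTop (2 / ε), hlin.eventually_ge_atTop 1] with n h1 h2
  set y : ℝ := (n : ℝ) ^ (1 / ((k : ℝ) - 2)) with hy
  have hy0 : 0 ≤ y := by positivity
  have hyk : y ^ (k - 2) = n := by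
    have : ((k - 2 : ℕ) : ℝ) = (k : ℝ) - 2 := by
      rw [Nat.cast_sub (by omega)]
      simp
    rw [← Real.rpow_natCast, this, hy, ← Real.rpow_mul (by positivity), one_div,
      inv_mul_cancel₀ hK.ne', Real.rpow_one]
  refine le_minColors_of_elim (by omega) hH ?_
  have h3 : (1 - ε) * y + 1 ≤ (1 - ε / 2) * y := by
    have : 1 ≤ ε / 2 * y := by
      calc (1 : ℝ) = ε / 2 * (2 / ε) := by field_simp
        _ ≤ _ := by gcongr
    linarith
  have h4 : ((1 - ε) * y + 1) ^ (k - 2) ≤ c * n := by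
    calc ((1 - ε) * y + 1) ^ (k - 2) ≤ ((1 - ε / 2) * y) ^ (k - 2) := by
          refine pow_le_pow_left₀ ?_ h3 _
          have := mul_nonneg (sub_nonneg.2 hε1.le) hy0
          linarith
      _ = c * n := by rw [mul_pow, hyk]
  linarith

/-! ### From edge colorings to linear codes. -/

/-- The cosets of the unit vectors, as an edge coloring. -/
def cosetColoring {n : ℕ} (C : Submodule (ZMod 2) (GraphSpace n)) :
    SimpleGraph.TopEdgeLabeling (Fin n) (GraphSpace n ⧸ C) :=
  open scoped Classical in fun e => C.mkQ (Pi.single e 1)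

theorem isCopyOf_map {V W : Type*} (H : SimpleGraph V) (f : V ↪ W) : IsCopyOf (H.map f) H := by
  refine ⟨Set.range f, ⟨⟨Equiv.ofInjective f f.injective, ?_⟩⟩, ?_⟩
  · intro a b
    simp
  · intro w hw v hv
    obtain ⟨a, b, -, rfl, -⟩ := (SimpleGraph.map_adj _ _ _ _).1 hv
    exact hw ⟨a, rfl⟩

-- The indicator vector of the copy is the sum of its unit vectors. Modulo `C` each coset occurs an
-- even number of times in that sum, so it vanishes in characteristic two.
open scoped Classical in
theorem containsCopy_of_admits {k n : ℕ} {H : SimpleGraph (Fin k)}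
    (C : Submodule (ZMod 2) (GraphSpace n)) (h : AdmitsEvenChromaticCopy H (cosetColoring C)) :
    ContainsCopy C H := by
  obtain ⟨f, hf⟩ := h
  refine ⟨H.map f.toEmbedding, ?_, isCopyOf_map H _⟩
  have hv : toVector (H.map f.toEmbedding) =
      ∑ e : H.edgeSet, (Pi.single (f.mapEdgeSet e) 1 : GraphSpace n) := by
    ext e
    rw [Finset.sum_apply]
    simp only [toVector, Pi.single_apply]
    by_cases he : (e : Sym2 (Fin n)) ∈ (H.map f.toEmbedding).edgeSet
    · rw [Set.indicator_of_mem he]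
      rw [SimpleGraph.edgeSet_map] at he
      obtain ⟨e', he', hee⟩ := he
      have hfe : e = f.mapEdgeSet ⟨e', he'⟩ := Subtype.ext hee.symm
      rw [Finset.sum_eq_single ⟨e', he'⟩]
      · simp [hfe]
      · intro b _ hb
        rw [if_neg]
        intro h
        exact hb (f.mapEdgeSet.injective (h.symm.trans hfe))
      · simp
    · rw [Set.indicator_of_notMem he]
      symm
      refine Finset.sum_eq_zero fun e' _ => if_neg fun h => he ?_
      rw [SimpleGraph.edgeSet_map]
      exact ⟨e', e'.2, by rw [h]; rfl⟩
  rw [← Submodule.Quotient.mk_eq_zero, ← Submodule.mkQ_apply, hv, map_sum]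
  change ∑ e : H.edgeSet, cosetColoring C (f.mapEdgeSet e) = 0
  rw [← Finset.sum_fiberwise_of_maps_to
    (t := Finset.univ.image fun e => cosetColoring C (f.mapEdgeSet e))
    (g := fun e => cosetColoring C (f.mapEdgeSet e))
    (fun e _ => Finset.mem_image_of_mem _ (Finset.mem_univ e))]
  refine Finset.sum_eq_zero fun c _ => ?_
  rw [Finset.sum_congr rfl (g := fun _ => c) (fun e he => (Finset.mem_filter.1 he).2),
    Finset.sum_const]
  have hev := hf c
  rw [Set.ncard_eq_toFinset_card'] at hev
  have heq : {e : H.edgeSet | cosetColoring C (f.mapEdgeSet e) = c}.toFinset =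
      Finset.univ.filter fun e : H.edgeSet => cosetColoring C (f.mapEdgeSet e) = c := by
    ext; simp
  rw [heq] at hev
  obtain ⟨t, ht⟩ := hev
  rw [ht, ← two_mul, mul_comm, mul_smul, ← Nat.cast_smul_eq_nsmul (ZMod 2) 2 c]
  have h2 : ((2 : ℕ) : ZMod 2) = 0 := by decide
  rw [h2, zero_smul, smul_zero]

theorem AdmitsEvenChromaticCopy.of_injective {V K L : Type*} {n : ℕ} {H : SimpleGraph V}
    {χ : SimpleGraph.TopEdgeLabeling (Fin n) K} {g : K → L} (hg : Function.Injective g)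
    (h : AdmitsEvenChromaticCopy H (fun e => g (χ e))) : AdmitsEvenChromaticCopy H χ := by
  obtain ⟨f, hf⟩ := h
  refine ⟨f, fun c => ?_⟩
  simpa [hg.eq_iff] using hf (g c)

theorem minColors_le_card_quotient {k n : ℕ} {H : SimpleGraph (Fin k)}
    (C : Submodule (ZMod 2) (GraphSpace n)) (h : ¬ ContainsCopy C H) :
    minColors H n ≤ Nat.card (GraphSpace n ⧸ C) := by
  refine sInf_le ⟨_, rfl, fun e => Finite.equivFin _ (cosetColoring C e), fun hadm => h ?_⟩
  exact containsCopy_of_admits C (hadm.of_injective (Equiv.injective _))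

theorem card_graphSpace (n : ℕ) : Nat.card (GraphSpace n) = 2 ^ n.choose 2 := by
  classical
  rw [Nat.card_eq_fintype_card, Fintype.card_fun, ZMod.card, ← SimpleGraph.edgeFinset_card,
    SimpleGraph.card_edgeFinset_top_eq_card_choose_two, Fintype.card_fin]

theorem linDensity_le_inv {k n : ℕ} {H : SimpleGraph (Fin k)} {x : ℝ} (hx : 0 < x)
    (h : ENNReal.ofReal x ≤ (minColors H n : ℝ≥0∞)) : linDensity H n ≤ x⁻¹ := by
  unfold linDensity
  rw [div_le_iff₀ (by positivity)]
  refine Real.sSup_le ?_ (by positivity)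
  rintro _ ⟨C, hC, rfl⟩
  have hq : x ≤ Nat.card (GraphSpace n ⧸ C) := by
    have h1 := h.trans (ENat.toENNReal_le.2 (minColors_le_card_quotient C hC))
    rw [ENat.toENNReal_coe, ENNReal.ofReal_le_natCast] at h1
    exact h1
  have hcard := Submodule.card_eq_card_quotient_mul_card C
  rw [card_graphSpace] at hcard
  have hcard' : (2 : ℝ) ^ n.choose 2 = Nat.card C * Nat.card (GraphSpace n ⧸ C) := by
    exact_mod_cast hcard
  rw [hcard', ← div_eq_inv_mul, le_div_iff₀ hx]
  gcongr

theorem ColorBound.codeBound {k : ℕ} {H : SimpleGraph (Fin k)} (h : ColorBound H) :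
    CodeBound H := by
  intro ε hε
  -- Chosen so that `1 - ε / (1 + ε)` is exactly the inverse of `1 + ε`.
  have hε' : 0 < ε / (1 + ε) := by positivity
  filter_upwards [h _ hε', eventually_gt_atTop 0] with n hn hn0
  have h1 : 1 - ε / (1 + ε) = (1 + ε)⁻¹ := by field_simp; ring
  rw [h1] at hn
  have hn0' : (0 : ℝ) < n := by exact_mod_cast hn0
  refine (linDensity_le_inv (by positivity) hn).trans (le_of_eq ?_)
  rw [mul_inv, inv_inv, neg_div, Real.rpow_neg hn0'.le]

/-! ### A deterministic criterion for elimination. -/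

/-- The vertices of `R` are pairwise nonadjacent. -/
def Indep {V : Type*} (R : Finset V) (G : SimpleGraph V) : Prop :=
  ∀ a ∈ R, ∀ b ∈ R, ¬ G.Adj a b

section Elimination

open scoped Classical

variable {V : Type*} {G : SimpleGraph V}

theorem degIn_insert_self (S : Finset V) (u : V) : degIn G (insert u S) u = degIn G S u := by
  unfold degIn
  congr 1
  ext w
  simp only [Finset.mem_filter, Finset.mem_insert]
  constructor
  · rintro ⟨rfl | h, h'⟩
    · exact absurd h' (G.irrefl)
    · exact ⟨h, h'⟩
  · exact fun h => ⟨Or.inr h.1, h.2⟩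

theorem degIn_erase_self {S : Finset V} {u : V} (hu : u ∈ S) :
    degIn G (S.erase u) u = degIn G S u := by
  rw [← degIn_insert_self, Finset.insert_erase hu]

theorem degIn_erase_of_adj {S : Finset V} {u w : V} (hu : u ∈ S) (h : G.Adj w u) :
    degIn G (S.erase u) w + 1 = degIn G S w := by
  unfold degIn
  rw [Finset.filter_erase, Finset.card_erase_add_one]
  simp [hu, h]

theorem edgeCount_true_erase {S : Finset V} {u : V} (hu : u ∈ S) :
    edgeCount G (fun _ => True) S =
      degIn G S u + edgeCount G (fun _ => True) (S.erase u) := by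
  have := edgeCount_insert G (fun _ => True) (Finset.notMem_erase u S)
  simp only [and_true] at this
  rw [← degIn_erase_self hu, degIn, ← this, Finset.insert_erase hu]

theorem Elim.of_erase {S : Finset V} {u : V} (hu : u ∈ S) (hd : Even (degIn G S u))
    (h : Elim G (S.erase u)) : Elim G S := by
  rw [← degIn_erase_self hu] at hd
  have := Elim.insert u (S.erase u) (Finset.notMem_erase u S) hd h
  rwa [Finset.insert_erase hu] at this

theorem Indep.mono {R R' : Finset V} (h : Indep R G) (hR : R' ⊆ R) : Indep R' G :=
  fun a ha b hb => h a (hR ha) b (hR hb)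

theorem Indep.elim {R : Finset V} (h : Indep R G) : Elim G R := by
  induction R using Finset.induction_on with
  | empty => exact Elim.empty
  | insert u R hu ih =>
    have h0 : degIn G R u = 0 := by
      unfold degIn
      rw [Finset.card_eq_zero, Finset.filter_eq_empty_iff]
      exact fun w hw => h u (by simp) w (by simp [hw])
    refine Elim.of_erase (u := u) (by simp) ?_ ?_
    · rw [degIn_insert_self, h0]
      exact Even.zero
    · rw [Finset.erase_insert hu]
      exact ih (h.mono (Finset.subset_insert _ _))

theorem Indep.edgeCount_eq_zero {R : Finset V} (h : Indep R G) (p : Sym2 V → Prop) :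
    edgeCount G p R = 0 := by
  unfold edgeCount
  refine Finset.card_eq_zero.2 (Finset.eq_empty_of_forall_notMem fun e he => ?_)
  induction e with
  | _ a b =>
    rw [Finset.mem_filter, Finset.mk_mem_sym2_iff] at he
    exact h a he.1.1 b he.1.2 he.2.1

/-- An independent set `R` together with a few vertices `insert w₀ W` can be eliminated, provided
that each `w ∈ W` shares with `w₀` a common neighbour in `R` that has no other neighbours. -/
theorem elim_of_gadgets {R W : Finset V} {w₀ : V} (hw₀ : w₀ ∉ W)
    (hdisj : Disjoint R (insert w₀ W)) (hR : Indep R G)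
    (hgad : ∀ w ∈ W, ∃ r ∈ R, ∀ x ∈ insert w₀ W, G.Adj r x ↔ x = w ∨ x = w₀)
    (heven : Even (edgeCount G (fun _ => True) (R ∪ insert w₀ W))) :
    Elim G (R ∪ insert w₀ W) := by
  induction W using Finset.induction_on generalizing R with
  | empty =>
    have hw₀R : w₀ ∉ R := fun h => Finset.disjoint_left.1 hdisj h (by simp)
    have hS : (R ∪ insert w₀ ∅).erase w₀ = R := by
      ext x
      simp only [Finset.mem_erase, Finset.mem_union, Finset.mem_insert, Finset.notMem_empty]
      grind
    have hmem : w₀ ∈ R ∪ insert w₀ ∅ := by simp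
    -- Every remaining edge contains `w₀`, so its degree is the edge count, which has stayed even
    -- throughout.
    refine Elim.of_erase hmem ?_ ?_
    · rwa [edgeCount_true_erase hmem, hS, hR.edgeCount_eq_zero _, add_zero] at heven
    · rw [hS]
      exact hR.elim
  | insert w W hw ih =>
    have hw₀w : w₀ ≠ w := fun h => hw₀ (by simp [h])
    have hw₀W : w₀ ∉ W := fun h => hw₀ (by simp [h])
    -- Once `w` has even degree it is deleted and the induction takes over. `R'` is `R`, or `R`
    -- without the gadget spent on `w`.
    have key : ∀ R' ⊆ R, (∀ v ∈ W, ∃ r ∈ R', ∀ x ∈ insert w₀ W, G.Adj r x ↔ x = v ∨ x = w₀) →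
        Even (degIn G (R' ∪ insert w₀ (insert w W)) w) →
        Even (edgeCount G (fun _ => True) (R' ∪ insert w₀ (insert w W))) →
        Elim G (R' ∪ insert w₀ (insert w W)) := by
      intro R' hR' hg hd he
      have hmem : w ∈ R' ∪ insert w₀ (insert w W) := by simp
      have hwR : w ∉ R' := fun h => Finset.disjoint_left.1 hdisj (hR' h) (by simp)
      have hS : (R' ∪ insert w₀ (insert w W)).erase w = R' ∪ insert w₀ W := by
        ext x
        simp only [Finset.mem_erase, Finset.mem_union, Finset.mem_insert]
        grind
      refine Elim.of_erase hmem hd ?_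
      rw [hS]
      refine ih hw₀W (Finset.disjoint_of_subset_left hR' (Finset.disjoint_of_subset_right
        (Finset.insert_subset_insert _ (Finset.subset_insert _ _)) hdisj)) (hR.mono hR') hg ?_
      rw [edgeCount_true_erase hmem, hS] at he
      exact (Nat.even_add.1 he).1 hd
    by_cases hd : Even (degIn G (R ∪ insert w₀ (insert w W)) w)
    · refine key R le_rfl (fun v hv => ?_) hd heven
      obtain ⟨r, hr, h⟩ := hgad v (by simp [hv])
      exact ⟨r, hr, fun x hx => h x (by simp at hx ⊢; tauto)⟩
    · obtain ⟨r, hr, hrad⟩ := hgad w (by simp)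
      have hrW : r ∉ insert w₀ (insert w W) := fun h => Finset.disjoint_left.1 hdisj hr h
      have hmem : r ∈ R ∪ insert w₀ (insert w W) := by simp [hr]
      have hS : (R ∪ insert w₀ (insert w W)).erase r =
          R.erase r ∪ insert w₀ (insert w W) := by
        ext x
        simp only [Finset.mem_erase, Finset.mem_union, Finset.mem_insert] at hrW ⊢
        grind
      have hdr : degIn G (R ∪ insert w₀ (insert w W)) r = 2 := by
        unfold degIn
        rw [show (R ∪ insert w₀ (insert w W)).filter (fun x => G.Adj r x) = {w, w₀} from ?_]
        · exact Finset.card_pair hw₀w.symm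
        · ext x
          simp only [Finset.mem_filter, Finset.mem_union]
          constructor
          · rintro ⟨hx | hx, h⟩
            · exact absurd h (hR r hr x hx)
            · simpa using (hrad x hx).1 h
          · intro hx
            have hx' : x ∈ insert w₀ (insert w W) := by
              simp at hx ⊢; tauto
            exact ⟨Or.inr hx', (hrad x hx').2 (by simpa using hx)⟩
      have hdr2 : Even (degIn G (R ∪ insert w₀ (insert w W)) r) := by rw [hdr]; decide
      refine Elim.of_erase hmem hdr2 ?_
      have hwr : G.Adj w r := ((hrad w (by simp)).2 (Or.inl rfl)).symm
      have he := heven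
      rw [edgeCount_true_erase hmem] at he
      have he' := (Nat.even_add.1 he).1 hdr2
      have hd' := degIn_erase_of_adj hmem hwr
      rw [← hd', Nat.even_add_one, not_not] at hd
      rw [hS] at he' hd ⊢
      refine key _ (Finset.erase_subset _ _) (fun v hv => ?_) hd he'
      obtain ⟨r', hr', h⟩ := hgad v (by simp [hv])
      refine ⟨r', Finset.mem_erase.2 ⟨?_, hr'⟩, fun x hx => h x (by simp at hx ⊢; tauto)⟩
      -- The gadget of another `v` is not the one just spent, since `r` has no neighbours in `insert
      -- w₀ (insert w W)` besides `w` and `w₀`.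
      rintro rfl
      have hvw : v ≠ w := fun h => hw (h ▸ hv)
      have := (hrad v (by simp [hv])).1 ((h v (by simp [hv])).2 (Or.inl rfl))
      rcases this with h | h
      · exact hvw h
      · exact hw₀W (h ▸ hv)

end Elimination

/-! ### Counting by involutions and the second moment method. -/

section Counting

variable {Ω : Type*}

/-- The number of points with property `P`. -/
noncomputable def cnt (P : Ω → Prop) : ℝ := ({x | P x}.ncard : ℝ)

theorem cnt_nonneg (P : Ω → Prop) : 0 ≤ cnt P := Nat.cast_nonneg _

theorem cnt_mono [Finite Ω] {P Q : Ω → Prop} (h : ∀ x, P x → Q x) : cnt P ≤ cnt Q := by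
  unfold cnt
  exact_mod_cast Set.ncard_le_ncard (fun x hx => h x hx) (Set.toFinite _)

theorem cnt_congr {P Q : Ω → Prop} (h : ∀ x, P x ↔ Q x) : cnt P = cnt Q :=
  congrArg cnt (funext fun x => propext (h x))

theorem cnt_eq_add [Finite Ω] (P Q : Ω → Prop) :
    cnt P = cnt (fun x => P x ∧ Q x) + cnt (fun x => P x ∧ ¬ Q x) := by
  unfold cnt
  rw [← Nat.cast_add, ← Set.ncard_union_eq]
  · congr 2
    ext x
    simp only [Set.mem_union, Set.mem_ofPred_eq]
    tauto
  · rw [Set.disjoint_left]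
    rintro x ⟨-, h⟩ ⟨-, h'⟩
    exact h' h

/-- `τ` pairs the points of `P` satisfying `Q` with those that do not. This replaces independence of
a fair bit throughout. -/
theorem cnt_and_flip [Finite Ω] {P Q : Ω → Prop} {τ : Ω → Ω} (hτ : Function.Involutive τ)
    (hP : ∀ x, P x → P (τ x)) (hQ : ∀ x, Q (τ x) ↔ ¬ Q x) :
    cnt (fun x => P x ∧ Q x) = cnt P / 2 := by
  have h : cnt (fun x => P x ∧ ¬ Q x) = cnt (fun x => P x ∧ Q x) := by
    unfold cnt
    rw [← Set.ncard_image_of_injective _ hτ.injective]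
    congr 2
    ext x
    simp only [Set.mem_image, Set.mem_ofPred_eq]
    constructor
    · rintro ⟨y, ⟨hy, hy'⟩, rfl⟩
      exact ⟨hP y hy, (hQ y).2 hy'⟩
    · rintro ⟨hx, hx'⟩
      refine ⟨τ x, ⟨hP x hx, ?_⟩, hτ x⟩
      rw [hQ]
      simpa using hx'
  have := cnt_eq_add P Q
  linarith

theorem cnt_and_forall_flip [Finite Ω] {ι : Type*} (A : Finset ι) {P : Ω → Prop} {Q : ι → Ω → Prop}
    {τ : ι → Ω → Ω} (hτ : ∀ a ∈ A, Function.Involutive (τ a))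
    (hP : ∀ a ∈ A, ∀ x, P x → P (τ a x)) (hQ : ∀ a ∈ A, ∀ x, Q a (τ a x) ↔ ¬ Q a x)
    (hQ' : ∀ a ∈ A, ∀ b ∈ A, a ≠ b → ∀ x, Q b x → Q b (τ a x)) :
    cnt (fun x => P x ∧ ∀ a ∈ A, Q a x) = cnt P / 2 ^ A.card := by
  classical
  induction A using Finset.induction_on with
  | empty => simp
  | insert a A ha ih =>
    rw [Finset.card_insert_of_notMem ha, pow_succ, ← div_div, ← ih
      (fun b hb => hτ b (by simp [hb])) (fun b hb => hP b (by simp [hb]))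
      (fun b hb => hQ b (by simp [hb]))
      (fun b hb c hc => hQ' b (by simp [hb]) c (by simp [hc]))]
    rw [← cnt_and_flip (Q := Q a) (hτ a (by simp)) ?_ (hQ a (by simp))]
    · refine cnt_congr fun x => ?_
      simp only [Finset.forall_mem_insert]
      tauto
    · rintro x ⟨hx, hx'⟩
      refine ⟨hP a (by simp) x hx, fun b hb => hQ' a (by simp) b (by simp [hb]) ?_ x (hx' b hb)⟩
      rintro rfl
      exact ha hb

theorem cnt_exists_le [Finite Ω] {ι : Type*} (A : Finset ι) (Q : ι → Ω → Prop) {b : ℝ}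
    (h : ∀ a ∈ A, cnt (Q a) ≤ b) : cnt (fun x => ∃ a ∈ A, Q a x) ≤ A.card * b := by
  classical
  induction A using Finset.induction_on with
  | empty => simp [cnt]
  | insert a A ha ih =>
    have h1 := cnt_eq_add (fun x => ∃ v ∈ insert a A, Q v x) (Q a)
    have h2 : cnt (fun x => (∃ v ∈ insert a A, Q v x) ∧ Q a x) ≤ cnt (Q a) :=
      cnt_mono fun x hx => hx.2
    have h3 : cnt (fun x => (∃ v ∈ insert a A, Q v x) ∧ ¬ Q a x) ≤
        cnt (fun x => ∃ a ∈ A, Q a x) := by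
      refine cnt_mono fun x hx => ?_
      obtain ⟨⟨c, hc, hQ⟩, hx⟩ := hx
      rcases Finset.mem_insert.1 hc with rfl | hc
      · exact absurd hQ hx
      · exact ⟨c, hc, hQ⟩
    have h4 := ih fun c hc => h c (by simp [hc])
    have h5 := h a (by simp)
    rw [Finset.card_insert_of_notMem ha]
    push_cast
    linarith

/-- Second moment method: if `F` is unlikely within each of many pairwise independent events of
the same probability, then `F` is unlikely. -/
theorem cnt_le_of_pairwise_indep [Finite Ω] {q : ℕ} {I : Fin q → Ω → Prop} {F : Ω → Prop} {p N δ : ℝ}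
    (hN : N = cnt (fun _ : Ω => True)) (hp : 0 < p) (hq : 0 < q) (hδ : 0 < δ)
    (hI : ∀ i, cnt (I i) = p * N) (hII : ∀ i j, i ≠ j → cnt (fun x => I i x ∧ I j x) = p ^ 2 * N)
    (hF : ∀ i, cnt (fun x => F x ∧ I i x) ≤ δ * (p * N)) :
    cnt F ≤ (1 / (2 * δ * (q * p)) + 3 / 2 * δ) * N := by
  classical
  have := Fintype.ofFinite Ω
  have hcnt : ∀ P : Ω → Prop, cnt P = ∑ x, if P x then (1 : ℝ) else 0 := by
    intro P
    unfold cnt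
    rw [Set.ncard_eq_toFinset_card', Finset.sum_boole]
    congr 2
    ext; simp
  have hN0 : 0 ≤ N := hN ▸ cnt_nonneg _
  -- `X` counts the events that occur; its mean is `E = q * p` and its variance is at most `E`.
  set X : Ω → ℝ := fun x => ∑ i, if I i x then (1 : ℝ) else 0 with hX
  have hX1 : ∑ x, X x = q * p * N := by
    simp only [hX]
    rw [Finset.sum_comm]
    simp only [← hcnt, hI]
    simp
    ring
  have hX2 : ∑ x, X x ^ 2 ≤ q * p * N + q ^ 2 * p ^ 2 * N := by
    have h1 : ∀ x, X x ^ 2 = ∑ i, ∑ j, if I i x ∧ I j x then (1 : ℝ) else 0 := by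
      intro x
      simp only [hX]
      rw [sq, Finset.sum_mul_sum]
      refine Finset.sum_congr rfl fun i _ => Finset.sum_congr rfl fun j _ => ?_
      split_ifs <;> simp_all
    have h2 : ∑ x, X x ^ 2 = ∑ i, ∑ j, cnt (fun x => I i x ∧ I j x) := by
      simp only [h1, hcnt]
      rw [Finset.sum_comm]
      refine Finset.sum_congr rfl fun i _ => ?_
      rw [Finset.sum_comm]
      congr!
    rw [h2]
    calc ∑ i, ∑ j, cnt (fun x => I i x ∧ I j x)
        ≤ ∑ i : Fin q, ∑ j : Fin q, ((if i = j then p * N else 0) + p ^ 2 * N) := by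
          refine Finset.sum_le_sum fun i _ => Finset.sum_le_sum fun j _ => ?_
          split_ifs with hij
          · subst hij
            simp only [and_self, hI]
            nlinarith [mul_nonneg (sq_nonneg p) hN0]
          · rw [hII i j hij, zero_add]
      _ = _ := by
          simp [Finset.sum_add_distrib]
          ring
  have hXF : ∑ x, (if F x then X x else 0) ≤ δ * (q * p) * N := by
    have h1 : ∑ x, (if F x then X x else 0) = ∑ i, cnt (fun x => F x ∧ I i x) := by
      simp only [hcnt]
      rw [Finset.sum_comm]
      refine Finset.sum_congr rfl fun x _ => ?_
      split_ifs with h <;> simp [hX, h]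
    rw [h1]
    calc _ ≤ ∑ i : Fin q, δ * (p * N) := Finset.sum_le_sum fun i _ => hF i
      _ = _ := by simp; ring
  have hcard : ∑ _x : Ω, (1 : ℝ) = N := by rw [hN, hcnt]; simp
  set E : ℝ := q * p with hE
  have hE0 : 0 < E := by positivity
  -- On `F`, write `E = X + (E - X)` and bound `E - X` by the inequality `t ≤ t ^ 2 / (2 * l) + l /
  -- 2` with `l = δ * E`.
  have hpt : ∀ x, (if F x then E else 0) ≤
      (if F x then X x else 0) + ((E - X x) ^ 2 / (2 * (δ * E)) + δ * E / 2) := by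
    intro x
    have hl : 0 < δ * E := by positivity
    have key : E - X x ≤ (E - X x) ^ 2 / (2 * (δ * E)) + δ * E / 2 := by
      rw [div_add_div _ _ (by positivity) (by norm_num), le_div_iff₀ (by positivity)]
      nlinarith [sq_nonneg (E - X x - δ * E)]
    split_ifs
    · linarith
    · have : 0 ≤ (E - X x) ^ 2 / (2 * (δ * E)) := by positivity
      linarith
  have hsum := Finset.sum_le_sum fun x (_ : x ∈ Finset.univ) => hpt x
  have hl : ∑ x, (if F x then E else 0) = E * cnt F := by
    rw [hcnt, Finset.mul_sum]
    simp
  have hvar : ∑ x, (E - X x) ^ 2 ≤ E * N := by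
    have : ∑ x, (E - X x) ^ 2 = E ^ 2 * ∑ _x : Ω, (1 : ℝ) - 2 * E * ∑ x, X x + ∑ x, X x ^ 2 := by
      rw [Finset.mul_sum, Finset.mul_sum, ← Finset.sum_sub_distrib, ← Finset.sum_add_distrib]
      exact Finset.sum_congr rfl fun x _ => by ring
    rw [this, hcard, hX1]
    have : q ^ 2 * p ^ 2 * N = E ^ 2 * N := by rw [hE]; ring
    nlinarith
  have hconst : ∑ _x : Ω, δ * E / 2 = δ * E / 2 * N := by
    rw [← hcard, Finset.mul_sum]
    simp
  rw [hl, Finset.sum_add_distrib, Finset.sum_add_distrib, ← Finset.sum_div, hconst] at hsum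
  have h3 : (∑ x, (E - X x) ^ 2) / (2 * (δ * E)) ≤ E * N / (2 * (δ * E)) := by gcongr
  have h4 : E * N / (2 * (δ * E)) = E * (1 / (2 * δ * E) * N) := by
    field_simp
  have h5 : E * cnt F ≤ E * ((1 / (2 * δ * E) + 3 / 2 * δ) * N) := by
    calc E * cnt F ≤ δ * E * N + (E * (1 / (2 * δ * E) * N) + δ * E / 2 * N) := by linarith
      _ = _ := by ring
  exact le_of_mul_le_mul_left h5 hE0

end Counting

/-! ### Toggling a single edge. -/

section Toggle

open scoped Classical

variable {V : Type*} {G G' : SimpleGraph V}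

/-- Add the edge `e` if it is missing, and delete it otherwise. -/
def toggle (e : Sym2 V) (G : SimpleGraph V) : SimpleGraph V :=
  symmDiff G (SimpleGraph.fromEdgeSet {e})

theorem toggle_involutive (e : Sym2 V) : Function.Involutive (toggle e) :=
  fun _ => symmDiff_symmDiff_cancel_right _ _

theorem toggle_adj {e : Sym2 V} {x y : V} :
    (toggle e G).Adj x y ↔ ((G.Adj x y ∧ (s(x, y) ≠ e)) ∨ (¬ G.Adj x y ∧ s(x, y) = e ∧ x ≠ y)) := by
  have := G.ne_of_adj (a := x) (b := y)
  simp only [toggle, symmDiff, SimpleGraph.sup_adj, SimpleGraph.sdiff_adj,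
    SimpleGraph.fromEdgeSet_adj, Set.mem_singleton_iff]
  tauto

theorem toggle_adj_of_ne {e : Sym2 V} {x y : V} (h : s(x, y) ≠ e) :
    (toggle e G).Adj x y ↔ G.Adj x y := by
  rw [toggle_adj]
  tauto

theorem toggle_adj_self {x y : V} (h : x ≠ y) :
    (toggle s(x, y) G).Adj x y ↔ ¬ G.Adj x y := by
  rw [toggle_adj]
  tauto

/-- `G` and `G'` induce the same graph on `S`. -/
def AgreeOn (S : Finset V) (G G' : SimpleGraph V) : Prop :=
  ∀ x ∈ S, ∀ y ∈ S, G.Adj x y ↔ G'.Adj x y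

theorem agreeOn_toggle {S : Finset V} {a b : V} (h : a ∉ S ∨ b ∉ S) :
    AgreeOn S G (toggle s(a, b) G) := by
  intro x hx y hy
  rw [toggle_adj_of_ne]
  intro he
  rcases Sym2.eq_iff.1 he with ⟨rfl, rfl⟩ | ⟨rfl, rfl⟩ <;> tauto

theorem AgreeOn.mono {S T : Finset V} (h : AgreeOn S G G') (hT : T ⊆ S) : AgreeOn T G G' :=
  fun x hx y hy => h x (hT hx) y (hT hy)

theorem AgreeOn.symm {S : Finset V} (h : AgreeOn S G G') : AgreeOn S G' G :=
  fun x hx y hy => (h x hx y hy).symm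

theorem AgreeOn.indep {S : Finset V} (h : AgreeOn S G G') (hS : Indep S G) : Indep S G' :=
  fun x hx y hy hxy => hS x hx y hy ((h x hx y hy).2 hxy)

theorem AgreeOn.edgeCount_eq {S : Finset V} (h : AgreeOn S G G') (p : Sym2 V → Prop) :
    edgeCount G p S = edgeCount G' p S := by
  unfold edgeCount
  congr 1
  refine Finset.filter_congr fun e he => and_congr_left fun _ => ?_
  induction e with
  | _ x y =>
    rw [Finset.mk_mem_sym2_iff] at he
    exact h x he.1 y he.2

theorem AgreeOn.elim {S : Finset V} (h : AgreeOn S G G') (hS : Elim G S) : Elim G' S := by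
  induction hS with
  | empty => exact Elim.empty
  | insert u S hu hd _ ih =>
    refine Elim.of_erase (u := u) (by simp) ?_ ?_
    · rw [degIn_insert_self]
      convert hd using 1
      unfold degIn
      congr 1
      refine Finset.filter_congr fun w hw => ?_
      exact (h u (by simp) w (by simp [hw])).symm
    · rw [Finset.erase_insert hu]
      exact ih (h.mono (Finset.subset_insert _ _))

theorem degIn_toggle_of_ne {S : Finset V} {a b v : V} (ha : v ≠ a) (hb : v ≠ b) :
    degIn (toggle s(a, b) G) S v = degIn G S v := by
  unfold degIn
  congr 1
  refine Finset.filter_congr fun w _ => toggle_adj_of_ne fun he => ?_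
  rcases Sym2.eq_iff.1 he with ⟨rfl, rfl⟩ | ⟨rfl, rfl⟩ <;> tauto

theorem even_degIn_toggle {S : Finset V} {a b : V} (hab : a ≠ b) (hb : b ∈ S) :
    Even (degIn (toggle s(a, b) G) S a) ↔ ¬ Even (degIn G S a) := by
  have key : ∀ G' : SimpleGraph V, degIn G' S a =
      degIn G' (S.erase b) a + if G'.Adj a b then 1 else 0 := by
    intro G'
    split_ifs with h
    · exact (degIn_erase_of_adj hb h).symm
    · unfold degIn
      rw [Finset.filter_erase, Finset.erase_eq_of_notMem (by simp [h]), add_zero]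
  have hsame : degIn (toggle s(a, b) G) (S.erase b) a = degIn G (S.erase b) a := by
    unfold degIn
    congr 1
    refine Finset.filter_congr fun w hw => toggle_adj_of_ne fun he => ?_
    exact Finset.ne_of_mem_erase hw (Sym2.congr_right.1 he)
  rw [key, key G, hsame]
  simp only [toggle_adj_self hab]
  split_ifs <;> simp_all [Nat.even_add_one]

theorem even_degIn_toggle' {S : Finset V} {a b : V} (hab : a ≠ b) (ha : a ∈ S) :
    Even (degIn (toggle s(a, b) G) S b) ↔ ¬ Even (degIn G S b) := by
  rw [Sym2.eq_swap]
  exact even_degIn_toggle hab.symm ha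

end Toggle

/-! ### The probability that elimination fails, given an independent set. -/

section Probability

open scoped Classical

variable {V : Type*}

/-- `R` is independent and `S` has an even number of edges, but `S` cannot be eliminated. -/
def Bad (R S : Finset V) (G : SimpleGraph V) : Prop :=
  Indep R G ∧ Even (edgeCount G (fun _ => True) S) ∧ ¬ Elim G S

theorem Bad.congr {R S : Finset V} {G G' : SimpleGraph V} (hRS : R ⊆ S) (h : AgreeOn S G G')
    (hG : Bad R S G) : Bad R S G' :=
  ⟨(h.mono hRS).indep hG.1, h.edgeCount_eq _ ▸ hG.2.1, fun h' => hG.2.2 (h.symm.elim h')⟩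

theorem Bad.erase {R S : Finset V} {G : SimpleGraph V} {u : V} (hu : u ∈ S) (h : Bad R S G)
    (hd : Even (degIn G S u)) : Bad R (S.erase u) G := by
  refine ⟨h.1, ?_, fun h' => h.2.2 (Elim.of_erase hu hd h')⟩
  have := h.2.1
  rw [edgeCount_true_erase hu] at this
  exact (Nat.even_add.1 this).1 hd

/-- Toggling the edge from `a` to `w` changes the parity of `a` and of no other vertex of `A`, so
these parities are independent fair bits. -/
theorem cnt_odd_degrees [Finite V] {P : SimpleGraph V → Prop} {A S : Finset V} {w : V} (hw : w ∈ S)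
    (hwA : w ∉ A) (hP : ∀ a ∈ A, ∀ G, P G → P (toggle s(a, w) G)) :
    cnt (fun G => P G ∧ ∀ a ∈ A, ¬ Even (degIn G S a)) = cnt P / 2 ^ A.card := by
  have hne : ∀ a ∈ A, a ≠ w := fun a ha h => hwA (h ▸ ha)
  refine cnt_and_forall_flip A (τ := fun a => toggle s(a, w)) (fun a _ => toggle_involutive _) hP
    (fun a ha G => not_congr (even_degIn_toggle (hne a ha) hw)) ?_
  intro a ha b hb hab G h
  rwa [degIn_toggle_of_ne hab.symm (hne b hb)]

/-- Split by the first vertex `u` of `A`, in some order, with even degree. Then `S.erase u` is bad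
too, and edges at `u` are irrelevant to that. Those towards earlier vertices randomize the earlier
parities, and one towards `r ∈ R` randomizes that of `u`, so the successive terms are `b / 2`, `b /
4`, and so on. -/
theorem cnt_bad_le_add [Finite V] {R S A : Finset V} {b : ℝ} (hRS : R ⊆ S) (hR : R.Nonempty)
    (hAS : A ⊆ S \ R) (hb : ∀ u ∈ S \ R, cnt (Bad R (S.erase u)) ≤ b) :
    cnt (Bad R S) ≤
      b * (1 - 1 / 2 ^ A.card) + cnt (fun G => Bad R S G ∧ ∀ a ∈ A, ¬ Even (degIn G S a)) := by
  obtain ⟨r, hr⟩ := hR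
  induction A using Finset.induction_on with
  | empty => simp
  | insert u A hu ih =>
    have huS : u ∈ S \ R := hAS (by simp)
    have hA : A ⊆ S \ R := fun x hx => hAS (by simp [hx])
    have huS' := (Finset.mem_sdiff.1 huS).1
    have huR := (Finset.mem_sdiff.1 huS).2
    have hru : r ≠ u := fun h => huR (h ▸ hr)
    have hrA : ∀ a ∈ A, a ≠ r := fun a ha h => (Finset.mem_sdiff.1 (hA ha)).2 (h ▸ hr)
    have hRe : R ⊆ S.erase u := fun x hx => Finset.mem_erase.2 ⟨fun h => huR (h ▸ hx), hRS hx⟩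
    have hinv : ∀ G x, Bad R (S.erase u) G → Bad R (S.erase u) (toggle s(x, u) G) :=
      fun G x h => h.congr hRe (agreeOn_toggle (Or.inr (Finset.notMem_erase _ _)))
    have h1 : cnt (fun G => (Bad R S G ∧ ∀ a ∈ A, ¬ Even (degIn G S a)) ∧ Even (degIn G S u)) ≤
        b / 2 ^ A.card / 2 := by
      calc _ ≤ cnt (fun G => (Bad R (S.erase u) G ∧ ∀ a ∈ A, ¬ Even (degIn G S a)) ∧
            Even (degIn G S u)) := cnt_mono fun G h => ⟨⟨h.1.1.erase huS' h.2, h.1.2⟩, h.2⟩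
        _ = cnt (fun G => Bad R (S.erase u) G ∧ ∀ a ∈ A, ¬ Even (degIn G S a)) / 2 := by
          refine cnt_and_flip (toggle_involutive s(r, u)) ?_ fun G =>
            even_degIn_toggle' hru (hRS hr)
          rintro G ⟨h, h'⟩
          refine ⟨hinv G r h, fun a ha => ?_⟩
          rw [degIn_toggle_of_ne (hrA a ha) (by rintro rfl; exact hu ha)]
          exact h' a ha
        _ = cnt (Bad R (S.erase u)) / 2 ^ A.card / 2 := by
          rw [cnt_odd_degrees huS' hu fun a _ G h => hinv G a h]
        _ ≤ _ := by
          gcongr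
          exact hb u huS
    have h2 := cnt_eq_add (fun G => Bad R S G ∧ ∀ a ∈ A, ¬ Even (degIn G S a))
      (fun G => Even (degIn G S u))
    have h3 : cnt (fun G => (Bad R S G ∧ ∀ a ∈ A, ¬ Even (degIn G S a)) ∧ ¬ Even (degIn G S u)) =
        cnt (fun G => Bad R S G ∧ ∀ a ∈ insert u A, ¬ Even (degIn G S a)) := by
      refine cnt_congr fun G => ?_
      rw [Finset.forall_mem_insert]
      tauto
    have h4 := ih hA
    rw [Finset.card_insert_of_notMem hu, pow_succ]
    have h5 : b * (1 - 1 / (2 ^ A.card * 2)) = b * (1 - 1 / 2 ^ A.card) + b / 2 ^ A.card / 2 := by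
      field_simp
      ring
    linarith

theorem cnt_bad_step [Finite V] {R S : Finset V} {b : ℝ} (hRS : R ⊆ S) (hR : R.Nonempty) (hb0 : 0 ≤ b)
    (hb : ∀ u ∈ S \ R, cnt (Bad R (S.erase u)) ≤ b) :
    cnt (Bad R S) ≤ b + cnt (Indep R) / 2 ^ (S \ R).card := by
  have h := cnt_bad_le_add hRS hR le_rfl hb
  obtain ⟨r, hr⟩ := hR
  have h1 : cnt (fun G => Bad R S G ∧ ∀ a ∈ S \ R, ¬ Even (degIn G S a)) ≤
      cnt (Indep R) / 2 ^ (S \ R).card := by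
    rw [← cnt_odd_degrees (P := Indep R) (A := S \ R) (hRS hr) (by simp [hr])]
    · exact cnt_mono fun G h => ⟨h.1.1, h.2⟩
    · exact fun a ha G h => (agreeOn_toggle (Or.inl (Finset.mem_sdiff.1 ha).2)).indep h
  have h2 : 0 ≤ b * (1 / 2 ^ (S \ R).card) := by positivity
  linarith

/-- Iterating `cnt_bad_step` adds `1 / 2 ^ j` for `L < j ≤ m`, a geometric sum. -/
theorem cnt_bad_of_base [Finite V] {R : Finset V} {t : ℝ} {L : ℕ} (hR : R.Nonempty) (ht0 : 0 ≤ t)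
    (hbase : ∀ S, R ⊆ S → (S \ R).card = L → cnt (Bad R S) ≤ t * cnt (Indep R)) {m : ℕ}
    (hm : L ≤ m) {S : Finset V} (hRS : R ⊆ S) (hS : (S \ R).card = m) :
    cnt (Bad R S) ≤ (t + (1 / 2 ^ L - 1 / 2 ^ m)) * cnt (Indep R) := by
  induction m, hm using Nat.le_induction generalizing S with
  | base => simpa using hbase S hRS hS
  | succ m hm ih =>
    have hI := cnt_nonneg (Indep R)
    have hpow : (1 : ℝ) / 2 ^ m ≤ 1 / 2 ^ L := by
      gcongr
      norm_num
    have := cnt_bad_step (b := (t + (1 / 2 ^ L - 1 / 2 ^ m)) * cnt (Indep R)) hRS hR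
      (mul_nonneg (by linarith) hI) fun u hu => ?_
    · rw [hS] at this
      refine this.trans (le_of_eq ?_)
      rw [pow_succ]
      field_simp
      ring
    · obtain ⟨huS, huR⟩ := Finset.mem_sdiff.1 hu
      refine ih (fun x hx => Finset.mem_erase.2 ⟨fun h => huR (h ▸ hx), hRS hx⟩) ?_
      rw [Finset.erase_sdiff_comm, Finset.card_erase_of_mem hu, hS]
      rfl

/-- The vertices of `R'` have independent uniform neighbourhoods in `W`, so each misses the pattern
`X` with probability `1 - 1 / 2 ^ W.card`. -/
theorem cnt_no_gadget [Finite V] {R R' W X : Finset V} (hdisj : Disjoint R W) (hR' : R' ⊆ R) :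
    cnt (fun G => Indep R G ∧ ∀ r ∈ R', ¬ ∀ x ∈ W, (G.Adj r x ↔ x ∈ X)) =
      (1 - 1 / 2 ^ W.card) ^ R'.card * cnt (Indep R) := by
  induction R' using Finset.induction_on with
  | empty => simp
  | insert r R' hr ih =>
    have hrR : r ∈ R := hR' (by simp)
    have ih := ih fun x hx => hR' (by simp [hx])
    have hRW : ∀ a ∈ R, ∀ b ∈ W, a ≠ b := fun a ha b hb h =>
      Finset.disjoint_left.1 hdisj ha (h ▸ hb)
    set P : SimpleGraph V → Prop :=
      fun G => Indep R G ∧ ∀ r ∈ R', ¬ ∀ x ∈ W, (G.Adj r x ↔ x ∈ X) with hP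
    have h1 := cnt_eq_add P (fun G => ∀ x ∈ W, (G.Adj r x ↔ x ∈ X))
    have h2 : cnt (fun G => P G ∧ ∀ x ∈ W, (G.Adj r x ↔ x ∈ X)) = cnt P / 2 ^ W.card := by
      refine cnt_and_forall_flip (P := P) (Q := fun x G => (G.Adj r x ↔ x ∈ X)) W
        (τ := fun x => toggle s(r, x)) (fun _ _ => toggle_involutive _) ?_ ?_ ?_
      · rintro x hx G ⟨h, h'⟩
        refine ⟨(agreeOn_toggle (Or.inr fun h => hRW x h x hx rfl)).indep h, fun r' hr' hall => ?_⟩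
        refine h' r' hr' fun y hy => ?_
        rw [← hall y hy, toggle_adj_of_ne]
        intro he
        have hr'R : r' ∈ R := hR' (by simp [hr'])
        rcases Sym2.eq_iff.1 he with ⟨rfl, -⟩ | ⟨rfl, -⟩
        · exact hr hr'
        · exact hRW _ hr'R _ hx rfl
      · intro x hx G
        rw [toggle_adj_self (hRW r hrR x hx)]
        tauto
      · intro x hx y hy hxy G h
        rw [← h, toggle_adj_of_ne]
        intro he
        exact hxy (Sym2.congr_right.1 he).symm
    have h3 : cnt (fun G => P G ∧ ¬ ∀ x ∈ W, (G.Adj r x ↔ x ∈ X)) = cnt (fun G => Indep R G ∧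
        ∀ v ∈ insert r R', ¬ ∀ x ∈ W, (G.Adj v x ↔ x ∈ X)) := by
      refine cnt_congr fun G => ?_
      rw [Finset.forall_mem_insert]
      tauto
    rw [← h3, Finset.card_insert_of_notMem hr, pow_succ, mul_right_comm, ← ih]
    rw [h2] at h1
    have h4 : cnt P * (1 - 1 / 2 ^ W.card) = cnt P - cnt P / 2 ^ W.card := by ring
    linarith

/-- A bad graph violates `elim_of_gadgets`, so some `w` has no gadget; the union bound runs over all
`L` outside vertices. -/
theorem cnt_bad_base [Finite V] {R S : Finset V} {L : ℕ} (hL : 0 < L) (hRS : R ⊆ S)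
    (hS : (S \ R).card = L) :
    cnt (Bad R S) ≤ L * (1 - 1 / 2 ^ L) ^ R.card * cnt (Indep R) := by
  obtain ⟨w₀, hw₀⟩ := Finset.card_pos.1 (hS ▸ hL)
  have hdisj : Disjoint R (S \ R) := Finset.disjoint_sdiff
  have hins : insert w₀ ((S \ R).erase w₀) = S \ R := Finset.insert_erase hw₀
  have hun : R ∪ insert w₀ ((S \ R).erase w₀) = S := by
    rw [hins, Finset.union_sdiff_of_subset hRS]
  have h1 : cnt (Bad R S) ≤ cnt (fun G => ∃ w ∈ S \ R, Indep R G ∧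
      ∀ r ∈ R, ¬ ∀ x ∈ S \ R, (G.Adj r x ↔ x ∈ ({w, w₀} : Finset V))) := by
    refine cnt_mono fun G hG => ?_
    by_contra! hcon
    refine hG.2.2 ?_
    rw [← hun]
    refine elim_of_gadgets (Finset.notMem_erase _ _) (by rwa [hins]) hG.1 (fun w hw => ?_)
      (by rw [hun]; exact hG.2.1)
    obtain ⟨r, hr, h⟩ := hcon w (Finset.mem_of_mem_erase hw) hG.1
    refine ⟨r, hr, fun x hx => ?_⟩
    rw [hins] at hx
    simpa using h x hx
  refine h1.trans ?_
  have h2 := cnt_exists_le (S \ R) (fun w G => Indep R G ∧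
      ∀ r ∈ R, ¬ ∀ x ∈ S \ R, (G.Adj r x ↔ x ∈ ({w, w₀} : Finset V)))
      (fun w _ => (cnt_no_gadget hdisj le_rfl).le)
  rw [hS] at h2
  linarith

theorem cnt_bad_univ_le [Fintype V] {R : Finset V} {L : ℕ} (hL : 0 < L) (hR : R.Nonempty)
    (hcard : R.card + L ≤ Fintype.card V) :
    cnt (Bad R Finset.univ) ≤ (L * (1 - 1 / 2 ^ L) ^ R.card + 1 / 2 ^ L) * cnt (Indep R) := by
  have hpow : (1 : ℝ) / 2 ^ L ≤ 1 := by
    rw [div_le_one (by positivity)]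
    exact one_le_pow₀ (by norm_num)
  have hc : (Finset.univ \ R).card = Fintype.card V - R.card := by
    rw [Finset.card_sdiff_of_subset (Finset.subset_univ _), Finset.card_univ]
  have := cnt_bad_of_base (t := L * (1 - 1 / 2 ^ L) ^ R.card) hR
    (mul_nonneg (by positivity) (pow_nonneg (by linarith) _))
    (fun S hRS hS => cnt_bad_base hL hRS hS) (m := Fintype.card V - R.card) (by omega)
    (Finset.subset_univ R) hc
  refine this.trans (mul_le_mul_of_nonneg_right ?_ (cnt_nonneg _))
  have : (0 : ℝ) ≤ 1 / 2 ^ (Fintype.card V - R.card) := by positivity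
  linarith

theorem cnt_and_indep [Finite V] {R : Finset V} {P : SimpleGraph V → Prop}
    (hP : ∀ a ∈ R, ∀ b ∈ R, ∀ G, P G → P (toggle s(a, b) G)) :
    cnt (fun G => P G ∧ Indep R G) = 1 / 2 ^ R.card.choose 2 * cnt P := by
  have h := cnt_and_forall_flip (R.offDiag.image fun p => s(p.1, p.2)) (P := P)
    (Q := fun e G => e ∉ G.edgeSet) (τ := toggle) (fun e _ => toggle_involutive e) ?_ ?_ ?_
  · rw [show (R.offDiag.image fun p => s(p.1, p.2)).card = R.card.choose 2 from
      Sym2.card_image_offDiag R] at h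
    rw [one_div, ← div_eq_inv_mul, ← h]
    refine cnt_congr fun G => and_congr_right fun _ => ?_
    constructor
    · intro hI e he
      obtain ⟨⟨a, b⟩, hab, rfl⟩ := Finset.mem_image.1 he
      rw [Finset.mem_offDiag] at hab
      exact hI a hab.1 b hab.2.1
    · intro hQ a ha b hb hab
      exact hQ s(a, b) (Finset.mem_image.2 ⟨(a, b), by simp [ha, hb, hab.ne], rfl⟩) hab
  · intro e he G hG
    obtain ⟨⟨a, b⟩, hab, rfl⟩ := Finset.mem_image.1 he
    rw [Finset.mem_offDiag] at hab
    exact hP a hab.1 b hab.2.1 G hG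
  · intro e he G
    obtain ⟨⟨a, b⟩, hab, rfl⟩ := Finset.mem_image.1 he
    rw [Finset.mem_offDiag] at hab
    simp only [SimpleGraph.mem_edgeSet, toggle_adj_self hab.2.2]
  · intro e he e' he' hne G hG
    induction e' with
    | _ x y =>
      rw [SimpleGraph.mem_edgeSet] at hG ⊢
      rwa [toggle_adj_of_ne hne.symm]

end Probability

/-! ### Removing the conditioning and choosing the parameters. -/

theorem exists_disjoint_blocks {k q ρ : ℕ} (h : q * ρ ≤ k) :
    ∃ R : Fin q → Finset (Fin k), (∀ i, (R i).card = ρ) ∧ ∀ i j, i ≠ j → Disjoint (R i) (R j) := by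
  let f : Fin q × Fin ρ ↪ Fin k := finProdFinEquiv.toEmbedding.trans (Fin.castLEEmb h)
  refine ⟨fun i => Finset.univ.map ⟨fun a => f (i, a), fun a b hab => ?_⟩, by simp, ?_⟩
  · simpa using f.injective hab
  · intro i j hij
    rw [Finset.disjoint_left]
    intro x hx hx'
    simp only [Finset.mem_map, Finset.mem_univ, true_and] at hx hx'
    obtain ⟨a, rfl⟩ := hx
    obtain ⟨b, hb⟩ := hx'
    exact hij (by simpa using (congrArg Prod.fst (f.injective hb)).symm)

theorem cnt_not_elim_le {k q ρ L : ℕ} (hL : 0 < L) (hρ : 0 < ρ) (hq : 0 < q) (hk : q * ρ ≤ k)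
    (hk' : ρ + L ≤ k) {δ : ℝ} (hδ : 0 < δ)
    (hδ' : L * (1 - 1 / 2 ^ L) ^ ρ + 1 / 2 ^ L ≤ δ) :
    cnt (fun H : SimpleGraph (Fin k) =>
        Even (edgeCount H (fun _ => True) Finset.univ) ∧ ¬ Elim H Finset.univ) ≤
      (1 / (2 * δ * (q * (1 / 2 ^ ρ.choose 2))) + 3 / 2 * δ) *
        cnt (fun _ : SimpleGraph (Fin k) => True) := by
  obtain ⟨R, hR, hdisj⟩ := exists_disjoint_blocks hk
  have hI : ∀ i, cnt (Indep (R i)) =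
      1 / 2 ^ ρ.choose 2 * cnt (fun _ : SimpleGraph (Fin k) => True) := by
    intro i
    rw [← hR i, ← cnt_and_indep (R := R i) (fun _ _ _ _ _ h => h)]
    simp
  refine cnt_le_of_pairwise_indep (I := fun i => Indep (R i)) rfl (by positivity) hq hδ hI ?_ ?_
  -- Disjoint blocks share no potential edge, so their independence events are pairwise independent.
  · intro i j hij
    rw [cnt_and_indep, hI, hR]
    · ring
    · intro a ha b _ G hG
      exact (agreeOn_toggle (Or.inl (Finset.disjoint_right.1 (hdisj i j hij) ha))).indep hG
  · intro i
    rw [← hI i]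
    refine le_trans (cnt_mono (Q := Bad (R i) Finset.univ) fun G h => ⟨h.2, h.1⟩) ?_
    refine (cnt_bad_univ_le (L := L) hL ?_ ?_).trans ?_
    · rw [← Finset.card_pos, hR]
      exact hρ
    · simpa [hR] using hk'
    · rw [hR]
      exact mul_le_mul_of_nonneg_right hδ' (cnt_nonneg _)

theorem eventually_cnt_not_elim_le {η : ℝ} (hη : 0 < η) : ∀ᶠ k : ℕ in atTop,
    cnt (fun H : SimpleGraph (Fin k) =>
        Even (edgeCount H (fun _ => True) Finset.univ) ∧ ¬ Elim H Finset.univ) ≤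
      η * cnt (fun _ : SimpleGraph (Fin k) => True) := by
  -- The final bound is at most `δ + 3 / 2 * δ`. The order of choice is `L` for the geometric tail,
  -- then `ρ` for the missing gadgets, then `k` for a large expected number of independent blocks.
  set δ : ℝ := η / 3 with hδ
  have hδ0 : 0 < δ := by positivity
  obtain ⟨L, hL0, hL⟩ : ∃ L : ℕ, 0 < L ∧ (1 : ℝ) / 2 ^ L ≤ δ / 2 := by
    have h := tendsto_pow_atTop_nhds_zero_of_lt_one (r := (1 / 2 : ℝ)) (by norm_num) (by norm_num)
    obtain ⟨L, h1, h2⟩ := ((h.eventually_le_const (u := δ / 2) (by positivity)).and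
      (eventually_gt_atTop 0)).exists
    exact ⟨L, h2, by simpa using h1⟩
  obtain ⟨ρ, hρ0, hρ⟩ : ∃ ρ : ℕ, 0 < ρ ∧ (L : ℝ) * (1 - 1 / 2 ^ L) ^ ρ ≤ δ / 2 := by
    have h1 : (1 : ℝ) / 2 ^ L ≤ 1 := by
      rw [div_le_one (by positivity)]
      exact one_le_pow₀ (by norm_num)
    have h2 : (0 : ℝ) < 1 / 2 ^ L := by positivity
    have h := (tendsto_pow_atTop_nhds_zero_of_lt_one (r := 1 - (1 : ℝ) / 2 ^ L) (by linarith)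
      (by linarith)).const_mul (L : ℝ)
    rw [mul_zero] at h
    obtain ⟨ρ, h3, h4⟩ := ((h.eventually_le_const (u := δ / 2) (by positivity)).and
      (eventually_gt_atTop 0)).exists
    exact ⟨ρ, h4, h3⟩
  set p : ℝ := 1 / 2 ^ ρ.choose 2 with hp
  have hp0 : 0 < p := by positivity
  have hq : Tendsto (fun k : ℕ => 2 * δ * (((k / ρ : ℕ) : ℝ) * p)) atTop atTop :=
    ((tendsto_natCast_atTop_atTop.comp (Nat.tendsto_div_const_atTop hρ0.ne')).atTop_mul_const
      hp0).const_mul_atTop (by positivity)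
  filter_upwards [hq.eventually_ge_atTop (1 / δ), eventually_ge_atTop (ρ + L)] with k h1 h2
  refine (cnt_not_elim_le hL0 hρ0 (Nat.div_pos (by omega) hρ0) (Nat.div_mul_le_self k ρ) h2 hδ0
    (by linarith)).trans (mul_le_mul_of_nonneg_right ?_ (cnt_nonneg _))
  have h3 : 1 / (2 * δ * (((k / ρ : ℕ) : ℝ) * p)) ≤ δ := by
    rw [div_le_iff₀ (lt_of_lt_of_le (by positivity) h1)]
    calc (1 : ℝ) = δ * (1 / δ) := by field_simp
      _ ≤ _ := by gcongr
  linarith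

/-! ### Graphs with an even number of edges, and the limit. -/

theorem edgeCount_univ {V : Type*} [Fintype V] (H : SimpleGraph V) :
    edgeCount H (fun _ => True) Finset.univ = H.edgeSet.ncard := by
  unfold edgeCount
  rw [← Set.ncard_coe_finset]
  congr 1
  ext e
  simp

theorem cnt_even_edges {k : ℕ} (hk : 2 ≤ k) :
    cnt (fun H : SimpleGraph (Fin k) => Even H.edgeSet.ncard) =
      cnt (fun _ : SimpleGraph (Fin k) => True) / 2 := by
  classical
  set a : Fin k := ⟨0, by omega⟩
  set b : Fin k := ⟨1, by omega⟩
  have hab : a ≠ b := by simp [a, b]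
  rw [← cnt_and_flip (Q := fun H : SimpleGraph (Fin k) => Even H.edgeSet.ncard)
    (toggle_involutive s(a, b)) (fun _ h => h) fun G => ?_]
  · exact cnt_congr fun _ => by simp
  · have h1 : ∀ G' : SimpleGraph (Fin k), G'.edgeSet.ncard =
        degIn G' Finset.univ a + edgeCount G' (fun _ => True) (Finset.univ.erase a) := by
      intro G'
      rw [← edgeCount_univ, edgeCount_true_erase (Finset.mem_univ a)]
      congr!
    have h2 : edgeCount (toggle s(a, b) G) (fun _ => True) (Finset.univ.erase a) =
        edgeCount G (fun _ => True) (Finset.univ.erase a) :=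
      ((agreeOn_toggle (Or.inl (Finset.notMem_erase _ _))).edgeCount_eq _).symm
    rw [h1, h1 G, h2, Nat.even_add, Nat.even_add, even_degIn_toggle hab (Finset.mem_univ _)]
    tauto

end GraphCode

theorem mainTheorem5 :
    Tendsto
      (fun k : ℕ =>
        (({H ∈ GraphCode.evenGraphs k |
            GraphCode.ColorBound H ∧ GraphCode.CodeBound H}.ncard : ℕ) : ℝ) /
          ((GraphCode.evenGraphs k).ncard : ℝ))
      atTop (𝓝 1) := by
  rw [Metric.tendsto_nhds]
  intro ε hε
  filter_upwards [GraphCode.eventually_cnt_not_elim_le (η := ε / 4) (by positivity),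
    eventually_ge_atTop 3] with k hF hk
  set N : ℝ := GraphCode.cnt (fun _ : SimpleGraph (Fin k) => True) with hN
  set good : SimpleGraph (Fin k) → Prop :=
    fun H => GraphCode.ColorBound H ∧ GraphCode.CodeBound H with hgood
  have heven : ((GraphCode.evenGraphs k).ncard : ℝ) = N / 2 :=
    GraphCode.cnt_even_edges (by omega)
  have hN0 : 0 < N := by
    rw [hN, GraphCode.cnt, Nat.cast_pos, Set.ncard_pos (Set.toFinite _)]
    exact ⟨⊥, trivial⟩
  have hsplit := GraphCode.cnt_eq_add (fun H : SimpleGraph (Fin k) => Even H.edgeSet.ncard) good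
  -- Even graphs are half of all graphs, so this is a proportion of at most `ε / 2` among them.
  have hbad : GraphCode.cnt (fun H : SimpleGraph (Fin k) => Even H.edgeSet.ncard ∧ ¬ good H) ≤
      ε / 4 * N := by
    refine (GraphCode.cnt_mono fun H h => ⟨?_, fun hE => h.2 ?_⟩).trans hF
    · rw [GraphCode.edgeCount_univ]
      exact h.1
    · have hC := GraphCode.colorBound_of_elim hk hE
      exact ⟨hC, hC.codeBound⟩
  have hbad0 := GraphCode.cnt_nonneg
    (fun H : SimpleGraph (Fin k) => Even H.edgeSet.ncard ∧ ¬ good H)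
  rw [GraphCode.cnt_even_edges (by omega)] at hsplit
  change dist (GraphCode.cnt (fun H : SimpleGraph (Fin k) => Even H.edgeSet.ncard ∧ good H) /
    ((GraphCode.evenGraphs k).ncard : ℝ)) 1 < ε
  rw [heven, Real.dist_eq, abs_sub_lt_iff]
  constructor
  · rw [sub_lt_iff_lt_add, div_lt_iff₀ (by positivity)]
    nlinarith
  · rw [sub_lt_comm, lt_div_iff₀ (by positivity)]
    nlinarith
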